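/- Let $\mathbb T$ be the set of all finite words over the alphabet $\{1,2\}$, with root the empty word $\varnothing$. A \emph{rooted subtree} is a set $\mathbb U\subset\mathbb T$ that contains the parent $i_1\cdots i_{n-1}$ of each word $i_1\cdots i_n\in\mathbb U$ with $n\ge 1$; its boundary $\partial\mathbb U$ is the set of words outside $\mathbb U$ whose parent lies in $\mathbb U$, with $\partial\emptyset:=\{\varnothing\}$. Let $\omega_{\mathbf i}=(\tau_{\mathbf i},\kappa_{\mathbf i})$, $\mathbf i\in\mathbb T$, be i.i.d. uniformly distributed on $[0,1]\times\{1,2\}$. For $A\subset\mathbb T$ write $\mathbf i\xrightarrow{A}\infty$ if there are $j_1,j_2,\ldots\in\{1,2\}$ with $j_{k+1}\le\kappa_{\mathbf i j_1\cdots j_k}$ and $\mathbf i j_1\cdots j_k\in A$ for all $k\ge 0$. For $t\in[0,1]$ let $\mathbb T^t:=\{\mathbf i:\kappa_{\mathbf i}=1,\ \tau_{\mathbf i}\le t\}\cup\{\mathbf i:\kappa_{\mathbf i}=2\}$. Let $\Xi\subset(0,1]$ be closed in the relative topology of $(0,1]$. A random subset $\mathbb F$ of $\mathbb T$ \emph{solves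 the frozen percolation equation} for $\Xi$ if almost surely, for all $\mathbf i\in\mathbb T$: $\mathbf i\in\mathbb F$ if and only if $\kappa_{\mathbf i}=1$ and $\mathbf i1\xrightarrow{\mathbb T^t\setminus\mathbb F}\infty$ for some $t\in\Xi\cap(0,\tau_{\mathbf i}]$. Put $\Omega_{\mathbf j}:=(\omega_{\mathbf{ji}})_{\mathbf i\in\mathbb T}$ and $\mathbb F_{\mathbf j}:=\{\mathbf i\in\mathbb T:\mathbf{ji}\in\mathbb F\}$. Such an $\mathbb F$ is \emph{stationary} if the law of $(\Omega_{\mathbf j},\mathbb F_{\mathbf j})$ does not depend on $\mathbf j$; it is \emph{adapted} if for each finite rooted subtree $\mathbb U$ the family $(\Omega_{\mathbf j},\mathbb F_{\mathbf j})_{\mathbf j\in\partial\mathbb U}$ is independent of $(\omega_{\mathbf i})_{\mathbf i\in\mathbb U}$; it \emph{respects the tree structure} if for each finite rooted subtree $\mathbb U$ the random variables $(\Omega_{\mathbf j},\mathbb F_{\mathbf j})$, $\mathbf j\in\partial\mathbb U$, are independent. The \emph{burning time} of the root is $Y_\varnothing:=\inf\{t\in\Xi:\varnothing\xrightarrow{\mathbb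 T^t\setminus\mathbb F}\infty\}$, with $\inf\emptyset:=\infty$. Let $I:=[0,1]\cup\{\infty\}$ and, for $x,y\in I$, let $\chi[\tau,1](x,y):=x$ if $x>\tau$, $\chi[\tau,1](x,y):=\infty$ if $x\le\tau$, and $\chi[\tau,2](x,y):=x\wedge y$. A probability measure $\rho$ on $I$ \emph{solves the RDE} if $\chi[\omega](Y_1,Y_2)$ has law $\rho$ whenever $Y_1,Y_2$ have law $\rho$, $\omega$ is uniformly distributed on $[0,1]\times\{1,2\}$, and $Y_1,Y_2,\omega$ are independent. \textbf{Lemma.} For each relatively closed set $\Xi\subset(0,1]$ there exists a unique probability measure $\rho_\Xi$ on $I$ such that (i) $\rho_\Xi$ solves the RDE, (ii) $\rho_\Xi$ is concentrated on $\Xi\cup\{\infty\}$, and (iii) $\rho_\Xi([0,t])\ge\tfrac12 t$ for all $t\in\Xi$. Moreover, if $\mathbb F$ solves the frozen percolation equation for $\Xi$ and is stationary, adapted, and respects the tree structure, then the burning time $Y_\varnothing$ of the root has law $\rho_\Xi$. -/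

import Mathlib

open MeasureTheory ProbabilityTheory Set

noncomputable section

namespace FrozenPerc

/-- The binary tree: all finite words over a two-letter alphabet. The element `0 : Fin 2` plays the
role of the letter (or number of legal offspring) `1`, and `1 : Fin 2` that of `2`; the order is
the same. The root is `[]`, concatenation is `++`, the offspring of `i` are `i ++ [0]` and
`i ++ [1]`, and the parent of `i ≠ []` is `i.dropLast`. -/
abbrev Word := List (Fin 2)

/-- The mark `(τ, κ)` of a point: its activation time in `[0,1]` and its number of legal offspring
(`0 : Fin 2` codes one legal offspring, `1 : Fin 2` codes two). -/
abbrev Mark := unitInterval × Fin 2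

/-- The space `[0,1] ∪ {∞}`, with `∞` written `⊤`, in its Borel structure. -/
abbrev Time := WithTop unitInterval

/-- The uniform distribution on `[0,1] × {1,2}`. -/
def unifMark : Measure Mark :=
  (volume : Measure unitInterval).prod (uniformOn (Set.univ : Set (Fin 2)))

/-- A rooted subtree: a set of words that contains the parent of each of its non-root elements. -/
def IsRootedSubtree (U : Set Word) : Prop :=
  ∀ i ∈ U, i ≠ [] → i.dropLast ∈ U

/-- The boundary of a rooted subtree; that of the empty one is `{root}`. -/
def boundary (U : Set Word) : Set Word :=
  {i | (U = ∅ ∧ i = []) ∨ (i ∉ U ∧ i ≠ [] ∧ i.dropLast ∈ U)}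

/-- There is an infinite upwards path through `A` that starts at `i` and in which each next point
is a legal offspring of its parent; `j k` is the letter added in step `k + 1`. -/
def Percolates (w : Word → Mark) (A : Set Word) (i : Word) : Prop :=
  ∃ j : ℕ → Fin 2, ∀ k : ℕ,
    j k ≤ (w (i ++ (List.range k).map j)).2 ∧ i ++ (List.range k).map j ∈ A

/-- The set of all branching points and of all internal points activated by time `t`. -/
def activated (w : Word → Mark) (t : unitInterval) : Set Word :=
  {i | ((w i).2 = 0 ∧ (w i).1 ≤ t) ∨ (w i).2 = 1}

/-- The frozen percolation equation, for a realisation `w` of the marks and a set `F` of points. -/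
def FrozenEq (Ξ : Set unitInterval) (w : Word → Mark) (F : Set Word) : Prop :=
  ∀ i : Word, i ∈ F ↔
    (w i).2 = 0 ∧ ∃ t ∈ Ξ, 0 < t ∧ t ≤ (w i).1 ∧ Percolates w (activated w t \ F) (i ++ [0])

/-- The burning time of `i`: the infimum in `[0,1] ∪ {∞}` of the times in `Ξ` at which `i`
percolates, which is `∞` if there are none. -/
def burningTime (Ξ : Set unitInterval) (w : Word → Mark) (F : Set Word) (i : Word) : Time :=
  sInf ((fun t : unitInterval => (t : Time)) '' {t ∈ Ξ | Percolates w (activated w t \ F) i})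

/-- The map `χ[τ, κ](x, y)`. -/
def chi (m : Mark) (x y : Time) : Time :=
  if m.2 = 0 then (if (m.1 : Time) < x then x else ⊤) else min x y

theorem measurable_chi :
    Measurable (fun p : Mark × (Time × Time) => chi p.1 p.2.1 p.2.2) := by
  unfold chi
  refine Measurable.ite ?_ (Measurable.ite ?_ ?_ measurable_const) ?_
  · exact (measurable_snd.comp measurable_fst) (measurableSet_singleton (0 : Fin 2))
  · exact measurableSet_lt (by fun_prop) (by fun_prop)
  · fun_prop
  · exact Measurable.min (by fun_prop) (by fun_prop)

/-- `ρ` solves the recursive distributional equation: if `Y₁`, `Y₂` have law `ρ`, the mark `ω` is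
uniform, and the three are independent, then `χ[ω](Y₁, Y₂)` has law `ρ`. -/
def SolvesRDE (ρ : Measure Time) : Prop :=
  (unifMark.prod (ρ.prod ρ)).map (fun p => chi p.1 p.2.1 p.2.2) = ρ

/-- The law `ρ` solves the RDE, is concentrated on `Ξ ∪ {∞}`, and gives each `[0,t]` with `t ∈ Ξ`
at least the mass `t / 2`. -/
structure IsBurningLaw (Ξ : Set unitInterval) (ρ : Measure Time) : Prop where
  rde : SolvesRDE ρ
  concentrated : ρ ((fun t : unitInterval => (t : Time)) '' Ξ ∪ {⊤})ᶜ = 0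
  half_le : ∀ t ∈ Ξ, ENNReal.ofReal ((t : ℝ) / 2) ≤ ρ (Iic (t : Time))

section Random

variable {S : Type*} [MeasurableSpace S]

/-- `(τ_i, κ_i)` are i.i.d. and uniformly distributed on `[0,1] × {1,2}`. -/
structure IsUniformMarking (P : Measure S) (ω : Word → S → Mark) : Prop where
  measurable : ∀ i, Measurable (ω i)
  indep : iIndepFun ω P
  law : ∀ i, P.map (ω i) = unifMark

/-- The pair `(Ω_j, F_j)`: the marks and the set `F`, seen from the point `j`. -/
def shifted (ω : Word → S → Mark) (F : S → Set Word) (j : Word) (s : S) :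
    (Word → Mark) × Set Word :=
  (fun i => ω (j ++ i) s, {i | j ++ i ∈ F s})

/-- The law of `(Ω_j, F_j)` does not depend on `j`. -/
def IsStationary (P : Measure S) (ω : Word → S → Mark) (F : S → Set Word) : Prop :=
  ∀ j j' : Word, IdentDistrib (shifted ω F j) (shifted ω F j') P P

/-- For each finite rooted subtree `U`, the family of the `(Ω_j, F_j)` with `j ∈ ∂U` is independent
of the family of the marks of the points of `U`. -/
def IsAdapted (P : Measure S) (ω : Word → S → Mark) (F : S → Set Word) : Prop :=
  ∀ U : Set Word, U.Finite → IsRootedSubtree U →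
    IndepFun (fun s (j : boundary U) => shifted ω F j s) (fun s (i : U) => ω i s) P

/-- For each finite rooted subtree `U`, the `(Ω_j, F_j)` with `j ∈ ∂U` are independent. -/
def RespectsTree (P : Measure S) (ω : Word → S → Mark) (F : S → Set Word) : Prop :=
  ∀ U : Set Word, U.Finite → IsRootedSubtree U →
    iIndepFun (fun j : boundary U => shifted ω F (j : Word)) P

end Random

end FrozenPerc

end

noncomputable section

namespace FrozenPerc

/-! Write `F t = ρ [0,t]`. The RDE says that `F 0 = 0` and that the integral of `u` with respect to
`dF(u)` over `(s,t]` is `F t ^ 2 - F s ^ 2`. Hence `F` can grow continuously only along the critical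
line `F t = t / 2`, and an atom at `t` after the value `x` must lead to `t - x`. Condition (iii)
forces such an atom whenever `x < t / 2`.

For finite `Ξ` this builds `F` point by point. Every condition on `F` involves at most two values of
`F` and is closed, so compactness of `[0,1]^[0,1]` gives a solution for general `Ξ`. For uniqueness,
two solutions do not move apart across a gap of `Ξ` (`abs_sub_le_of_gap`). Between two points of `Ξ`
at distance at most `ε`, either they move no further apart or both lie within `ε` of each other
(`abs_sub_le_max`). Strips of width `ε` then bound the distance by `ε` on all of `Ξ`.

For the burning time, the RDE is the one-step recursion `burningTime_eq_chi` combined with the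
independence assumptions. Condition (iii) is a branching process argument: if `q = P(Y ≤ t)`, an
unburnt point has on average `1 - q + t / 2` unburnt offspring along paths activated by time `t`. If
`q < t / 2` this exceeds one, so with positive probability there is an infinite path of activated
unburnt points. Such a path avoids the frozen points, so the root burns by time `t`, a
contradiction. -/

/-! ### Distribution functions of solutions of the RDE. -/

/-- The distribution functions on `[0,1]` of the solutions of the RDE: those monotone functions
with `F 0 = 0` for which the integral of `u` with respect to `dF(u)` over `(s,t]` is
`F t ^ 2 - F s ^ 2`, the integral being expressed through the mean value property. -/
structure IsRDECDF (F : unitInterval → ℝ) : Prop where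
  mono : Monotone F
  zero : F 0 = 0
  lower : ∀ s t : unitInterval, s ≤ t → (s : ℝ) * (F t - F s) ≤ F t ^ 2 - F s ^ 2
  upper : ∀ s t : unitInterval, s ≤ t → F t ^ 2 - F s ^ 2 ≤ (t : ℝ) * (F t - F s)

/-- The function `F` does not grow off `Ξ`. -/
def GrowsOn (Ξ : Set unitInterval) (F : unitInterval → ℝ) : Prop :=
  ∀ s t, s ≤ t → Disjoint (Ioc s t) Ξ → F t = F s

/-- The distribution functions on `[0,1]` of the burning laws. -/
structure IsBurningCDF (Ξ : Set unitInterval) (F : unitInterval → ℝ) : Prop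
    extends IsRDECDF F where
  grows : GrowsOn Ξ F
  half_le : ∀ t ∈ Ξ, (t : ℝ) / 2 ≤ F t

namespace IsRDECDF

variable {F : unitInterval → ℝ}

theorem nonneg (hF : IsRDECDF F) (t : unitInterval) : 0 ≤ F t :=
  hF.zero ▸ hF.mono t.2.1

theorem le_coe (hF : IsRDECDF F) (t : unitInterval) : F t ≤ t := by
  have h := hF.upper 0 t t.2.1
  rw [hF.zero] at h
  by_contra! hlt
  have := t.2.1
  nlinarith

/-- If `F` does not grow on `(s,t)`, then it has either no atom at `t`, or one of the unique
possible size. -/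
theorem eq_or_add_eq (hF : IsRDECDF F) {s t : unitInterval} (hst : s < t)
    (hc : ∀ u, s < u → u < t → F u = F s) : F t = F s ∨ F t + F s = t := by
  have hle : (t : ℝ) * (F t - F s) ≤ F t ^ 2 - F s ^ 2 := by
    have hm := hF.mono hst.le
    by_contra! hlt
    have hpos : 0 < F t - F s := by
      rcases hm.lt_or_eq with h | h
      · linarith
      · rw [h] at hlt; simp at hlt
    -- The quotient is the mean location of the growth in `(s,t]`. All growth sits at `t`, so
    -- applying `lower` from a `u < t` beyond this mean gives a contradiction.
    have hq : max (s : ℝ) ((F t ^ 2 - F s ^ 2) / (F t - F s)) < t := by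
      rw [max_lt_iff, div_lt_iff₀ hpos]
      exact ⟨hst, hlt⟩
    obtain ⟨u, hu1, hu2⟩ := exists_between hq
    have hsu : (s : ℝ) < u := (le_max_left _ _).trans_lt hu1
    have hqu := (le_max_right _ _).trans_lt hu1
    rw [div_lt_iff₀ hpos] at hqu
    have hu : u ∈ unitInterval := ⟨s.2.1.trans hsu.le, hu2.le.trans t.2.2⟩
    have h := hF.lower ⟨u, hu⟩ t (Subtype.coe_le_coe.1 hu2.le)
    rw [hc ⟨u, hu⟩ (Subtype.coe_lt_coe.1 hsu) (Subtype.coe_lt_coe.1 hu2)] at h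
    dsimp only at h
    linarith
  have h : (F t - F s) * (F t + F s - t) = 0 := by
    linarith [hle, hF.upper s t hst.le]
  rcases mul_eq_zero.1 h with h | h
  · left; linarith
  · right; linarith

/-- If `F` is at least `t / 2` at time `t`, then it is Lipschitz to the right of `t`. -/
theorem sub_le (hF : IsRDECDF F) {t u : unitInterval} (htu : t ≤ u) (ht : (t : ℝ) / 2 ≤ F t) :
    F u - F t ≤ u - t := by
  have h := hF.upper t u htu
  have := hF.mono htu
  have h' : (t : ℝ) ≤ u := htu
  by_contra! hlt
  nlinarith

/-- Either `F` is constant between two times, or it is close to the critical line at both. -/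
theorem eq_or_add_le (hF : IsRDECDF F) {s t : unitInterval} (hst : s ≤ t) :
    F t = F s ∨ F t + F s ≤ t := by
  have h := hF.upper s t hst
  have hm := hF.mono hst
  rcases hm.lt_or_eq with hlt | heq
  · right
    by_contra! hgt
    nlinarith
  · exact Or.inl heq.symm

end IsRDECDF

/-! ### Existence: finite `Ξ`, then compactness. -/

/-- The distribution function that one obtains from `F` by adding an atom at time `b`. -/
theorem IsRDECDF.ite {F : unitInterval → ℝ} (hF : IsRDECDF F) (b : unitInterval) :
    IsRDECDF (fun t => if t < b then F t else max (F b) (b - F b)) := by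
  set y := max (F b) ((b : ℝ) - F b) with hy
  have hyb : F b ≤ y := le_max_left _ _
  -- The two roots of this quadratic in `y` are `F b` and `b - F b`; the larger one is at least `b /
  -- 2`.
  have hjump : y ^ 2 - F b ^ 2 = b * (y - F b) := by
    rcases le_total (F b) ((b : ℝ) - F b) with h | h
    · rw [hy, max_eq_right h]; ring
    · rw [hy, max_eq_left h]; ring
  refine ⟨?_, ?_, ?_, ?_⟩
  · intro s t hst
    beta_reduce
    split_ifs with h1 h2 h2
    · exact hF.mono hst
    · exact (hF.mono h1.le).trans hyb
    · exact absurd (hst.trans_lt h2) h1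
    · exact le_rfl
  · split_ifs with h
    · exact hF.zero
    · have h0 : b = 0 := le_antisymm (not_lt.1 h) b.2.1
      rw [hy, h0, hF.zero]; simp
  · intro s t hst
    split_ifs with h1 h2 h2
    · exact hF.lower s t hst
    · exact absurd (hst.trans_lt h1) h2
    · have h := hF.lower s b h2.le
      have h' : (s : ℝ) ≤ b := h2.le
      nlinarith
    · simp
  · intro s t hst
    split_ifs with h1 h2 h2
    · exact hF.upper s t hst
    · exact absurd (hst.trans_lt h1) h2
    · have h := hF.upper s b h2.le
      have h' : (b : ℝ) ≤ t := not_lt.1 h1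
      have := hF.mono h2.le
      nlinarith
    · simp

theorem exists_isBurningCDF_finset (A : Finset unitInterval) :
    ∃ F, IsBurningCDF (A : Set unitInterval) F := by
  induction A using Finset.induction_on_max with
  | empty =>
    refine ⟨fun _ => 0, ⟨⟨monotone_const, rfl, by simp, by simp⟩, fun _ _ _ _ => rfl, by simp⟩⟩
  | insert b A hA ih =>
    obtain ⟨F, hF⟩ := ih
    refine ⟨_, hF.toIsRDECDF.ite b, ?_, ?_⟩
    · intro s t hst hd
      dsimp only
      split_ifs with h1 h2 h2
      · refine hF.grows s t hst (hd.mono_right ?_)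
        simp
      · exact absurd (hst.trans_lt h1) h2
      · exact absurd (Finset.mem_coe.2 (Finset.mem_insert_self b A))
          (Set.disjoint_left.1 hd ⟨h2, not_lt.1 h1⟩)
      · rfl
    · intro t ht
      rcases Finset.mem_insert.1 (Finset.mem_coe.1 ht) with rfl | h
      · rw [if_neg (lt_irrefl _)]
        linarith [le_max_left (F t) ((t : ℝ) - F t), le_max_right (F t) ((t : ℝ) - F t)]
      · rw [if_pos (hA t h)]
        exact hF.half_le t h

/-- The finite intersection property applies to the lower bounds at the points of `Ξ`: finitely many
of them hold for the solution of a finite subset, which a fortiori does not grow off `Ξ`. Closedness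
of `Ξ` enters only later, for right-continuity and uniqueness. -/
theorem exists_isBurningCDF (Ξ : Set unitInterval) : ∃ F, IsBurningCDF Ξ F := by
  have hcpt : IsCompact ((Set.univ.pi fun _ : unitInterval => Icc (0 : ℝ) 1) ∩
      {F | IsRDECDF F ∧ GrowsOn Ξ F}) := by
    refine (isCompact_univ_pi fun _ => isCompact_Icc).inter_right ?_
    have : {F : unitInterval → ℝ | IsRDECDF F ∧ GrowsOn Ξ F} =
        {F | ∀ s t, s ≤ t → F s ≤ F t} ∩ {F | F 0 = 0} ∩
        {F | ∀ s t : unitInterval, s ≤ t → (s : ℝ) * (F t - F s) ≤ F t ^ 2 - F s ^ 2} ∩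
        {F | ∀ s t : unitInterval, s ≤ t → F t ^ 2 - F s ^ 2 ≤ (t : ℝ) * (F t - F s)} ∩
        {F | ∀ s t, s ≤ t → Disjoint (Ioc s t) Ξ → F t = F s} := by
      ext F
      constructor
      · rintro ⟨⟨h1, h2, h3, h4⟩, h5⟩
        exact ⟨⟨⟨⟨fun s t h => h1 h, h2⟩, h3⟩, h4⟩, h5⟩
      · rintro ⟨⟨⟨⟨h1, h2⟩, h3⟩, h4⟩, h5⟩
        exact ⟨⟨fun s t h => h1 s t h, h2, h3, h4⟩, h5⟩
    rw [this]
    simp only [ofPred_forall]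
    refine (((IsClosed.inter ?_ ?_).inter ?_).inter ?_).inter ?_
    · exact isClosed_iInter fun s => isClosed_iInter fun t => isClosed_iInter fun _ =>
        isClosed_le (by fun_prop) (by fun_prop)
    · exact isClosed_eq (by fun_prop) (by fun_prop)
    · exact isClosed_iInter fun s => isClosed_iInter fun t => isClosed_iInter fun _ =>
        isClosed_le (by fun_prop) (by fun_prop)
    · exact isClosed_iInter fun s => isClosed_iInter fun t => isClosed_iInter fun _ =>
        isClosed_le (by fun_prop) (by fun_prop)
    · exact isClosed_iInter fun s => isClosed_iInter fun t => isClosed_iInter fun _ =>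
        isClosed_iInter fun _ => isClosed_eq (by fun_prop) (by fun_prop)
  obtain ⟨F, ⟨-, h1, h2⟩, h3⟩ := hcpt.inter_iInter_nonempty
    (fun t : Ξ => {F : unitInterval → ℝ | (t : ℝ) / 2 ≤ F t})
    (fun t => isClosed_le (by fun_prop) (by fun_prop)) (by
      classical
      intro u
      obtain ⟨F, hF⟩ := exists_isBurningCDF_finset (u.image Subtype.val)
      refine ⟨F, ⟨fun t _ => ⟨hF.nonneg t, (hF.le_coe t).trans t.2.2⟩, hF.toIsRDECDF, ?_⟩, ?_⟩
      · intro s t hst hd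
        refine hF.grows s t hst (hd.mono_right ?_)
        intro x hx
        obtain ⟨y, -, rfl⟩ := Finset.mem_image.1 (Finset.mem_coe.1 hx)
        exact y.2
      · simp only [mem_iInter]
        intro t ht
        exact hF.half_le t (Finset.mem_coe.2 (Finset.mem_image_of_mem _ ht)))
  exact ⟨F, h1, h2, fun t ht => mem_iInter.1 h3 ⟨t, ht⟩⟩

/-! ### Right-continuity and uniqueness for closed `Ξ`. -/

theorem isClosed_insert_zero {Ξ : Set unitInterval}
    (hclosed : IsClosed ((↑) ⁻¹' Ξ : Set (Set.Ioc (0 : unitInterval) 1))) :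
    IsClosed (insert 0 Ξ) := by
  obtain ⟨C, hC, hCΞ⟩ := isClosed_induced_iff.1 hclosed
  have : insert 0 Ξ = insert 0 C := by
    ext t
    by_cases ht : t = 0
    · simp [ht]
    · have h : t ∈ Ioc (0 : unitInterval) 1 := ⟨lt_of_le_of_ne t.2.1 (Ne.symm ht), t.2.2⟩
      have := Set.ext_iff.1 hCΞ ⟨t, h⟩
      simp only [mem_preimage] at this
      simp [ht, this]
  rw [this, ← Set.union_singleton]
  exact hC.union isClosed_singleton

namespace IsBurningCDF

variable {Ξ : Set unitInterval} {F G : unitInterval → ℝ}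

theorem half_le' (hF : IsBurningCDF Ξ F) {t : unitInterval} (ht : t ∈ insert 0 Ξ) :
    (t : ℝ) / 2 ≤ F t := by
  rcases ht with rfl | ht
  · simp [hF.zero]
  · exact hF.half_le t ht

/-- At a point of `Ξ` the bound `sub_le` applies; off `Ξ` the function is locally constant. -/
theorem continuousWithinAt (hF : IsBurningCDF Ξ F) (hΞ : IsClosed (insert 0 Ξ))
    (t : unitInterval) : ContinuousWithinAt F (Ici t) t := by
  by_cases ht : t ∈ insert 0 Ξ
  · have h := hF.half_le' ht
    have hlim : Filter.Tendsto (fun u : unitInterval => F t + ((u : ℝ) - t))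
        (nhdsWithin t (Ici t)) (nhds (F t)) := by
      have : ContinuousWithinAt (fun u : unitInterval => F t + ((u : ℝ) - t)) (Ici t) t := by
        fun_prop
      simpa [ContinuousWithinAt] using this
    refine tendsto_of_tendsto_of_tendsto_of_le_of_le' tendsto_const_nhds hlim ?_ ?_
    · filter_upwards [self_mem_nhdsWithin] with u hu using hF.mono hu
    · filter_upwards [self_mem_nhdsWithin] with u hu
      linarith [hF.sub_le hu h]
  · have hn : (insert 0 Ξ)ᶜ ∈ nhdsWithin t (Ici t) :=
      mem_nhdsWithin_of_mem_nhds (hΞ.isOpen_compl.mem_nhds ht)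
    obtain ⟨b, -, hb, hbsub⟩ := exists_Icc_mem_subset_of_mem_nhdsGE hn
    refine ContinuousWithinAt.congr_of_eventuallyEq (f := fun _ => F t)
      continuousWithinAt_const ?_ rfl
    filter_upwards [hb] with u hu
    refine hF.grows t u hu.1 (Set.disjoint_left.2 fun x hx hxΞ => ?_)
    exact hbsub ⟨hx.1.le, hx.2.trans hu.2⟩ (Or.inr hxΞ)

/-- The distance of two solutions between neighbouring points of `Ξ`. -/
theorem abs_sub_le_of_gap (hF : IsBurningCDF Ξ F) (hG : IsBurningCDF Ξ G) {s t : unitInterval}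
    (ht : t ∈ insert 0 Ξ) (hst : s < t) (hd : Disjoint (Ioo s t) Ξ) :
    |F t - G t| ≤ |F s - G s| := by
  -- The value after a gap is the reflection of `F s` to the upper side of `t / 2`, and reflections
  -- do not increase distances.
  have key : ∀ {F}, IsBurningCDF Ξ F → F t = t / 2 + |F s - t / 2| := by
    intro F hF
    have h := hF.half_le' ht
    have hm := hF.mono hst.le
    have hc : ∀ u, s < u → u < t → F u = F s := fun u hsu hut =>
      hF.grows s u hsu.le (Set.disjoint_left.2 fun x hx =>
        Set.disjoint_left.1 hd ⟨hx.1, hx.2.trans_lt hut⟩)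
    rcases hF.eq_or_add_eq hst hc with h' | h'
    · rw [abs_of_nonneg] <;> linarith
    · rw [abs_of_nonpos] <;> linarith
  rw [key hF, key hG]
  have := abs_abs_sub_abs_le_abs_sub (F s - t / 2) (G s - t / 2)
  rwa [sub_sub_sub_cancel_right, ← add_sub_add_left_eq_sub _ _ ((t : ℝ) / 2)] at this

/-- The distance of two solutions at any two points of `Ξ`. -/
theorem abs_sub_le_max (hF : IsBurningCDF Ξ F) (hG : IsBurningCDF Ξ G) {s t : unitInterval}
    (hs : s ∈ insert 0 Ξ) (ht : t ∈ insert 0 Ξ) (hst : s ≤ t) :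
    |F t - G t| ≤ max |F s - G s| (t - s) := by
  have h1 := hF.half_le' hs
  have h2 := hF.half_le' ht
  have h3 := hG.half_le' hs
  have h4 := hG.half_le' ht
  have h5 := hF.mono hst
  have h6 := hG.mono hst
  have h7 : (s : ℝ) ≤ t := hst
  rw [le_max_iff]
  -- A function that moves has its value at `t` in `[t / 2, t - s / 2]`. If only one moves, either
  -- it lies above the constant one and the lower bound `t / 2` finishes, or it has risen towards
  -- it.
  rcases hF.eq_or_add_le hst with hf | hf <;> rcases hG.eq_or_add_le hst with hg | hg
  · left; rw [hf, hg]
  · rcases le_total (F t) (G t) with h | h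
    · right; rw [abs_of_nonpos] <;> linarith
    · left
      rw [abs_of_nonneg (by linarith)]
      exact le_trans (by linarith) (le_abs_self _)
  · rcases le_total (G t) (F t) with h | h
    · right; rw [abs_of_nonneg] <;> linarith
    · left
      rw [abs_of_nonpos (by linarith)]
      exact le_trans (by linarith) (neg_le_abs _)
  · right
    rw [abs_le]; constructor <;> linarith

/-- Induction over strips of width `ε`: the last point `s` before level `n * ε` and the first point
`u` after it bound a gap, and from `u` to `t` the distance is less than `ε`. -/
theorem abs_sub_le (hF : IsBurningCDF Ξ F) (hG : IsBurningCDF Ξ G)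
    (hΞ : IsClosed (insert 0 Ξ)) {ε : ℝ} (hε : 0 < ε) (n : ℕ) :
    ∀ t ∈ insert 0 Ξ, (t : ℝ) ≤ n * ε → |F t - G t| ≤ ε := by
  induction n with
  | zero =>
    intro t _ htn
    have h0 : t = 0 := le_antisymm (by exact_mod_cast (by simpa using htn : (t : ℝ) ≤ 0)) t.2.1
    rw [h0, hF.zero, hG.zero]
    simpa using hε.le
  | succ n ih =>
    intro t ht htn
    push_cast at htn
    by_cases hle : (t : ℝ) ≤ n * ε
    · exact ih t ht hle
    push Not at hle
    have hc : Continuous fun u : unitInterval => (u : ℝ) := continuous_subtype_val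
    obtain ⟨u, ⟨⟨hu, hun⟩, hut⟩, humin⟩ := ((hΞ.inter (isClosed_le continuous_const hc)).inter
      (isClosed_Iic (a := t))).isCompact.exists_isLeast ⟨t, ⟨ht, hle.le⟩, le_refl t⟩
    obtain ⟨s, ⟨hs, hsn⟩, hsmax⟩ := (hΞ.inter (isClosed_le hc continuous_const)).isCompact
      |>.exists_isGreatest (s := insert 0 Ξ ∩ {u : unitInterval | (u : ℝ) ≤ n * ε})
      ⟨0, Or.inl rfl, by simpa using by positivity⟩
    have hsu : |F u - G u| ≤ ε := by
      rcases lt_or_eq_of_le (show (n : ℝ) * ε ≤ u from hun) with h | h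
      · have hlt : s < u := Subtype.coe_lt_coe.1 (lt_of_le_of_lt hsn h)
        refine (hF.abs_sub_le_of_gap hG hu hlt (Set.disjoint_left.2 fun x hx hxΞ => ?_)).trans
          (ih s hs hsn)
        rcases le_total (x : ℝ) (n * ε) with h' | h'
        · exact absurd (hsmax ⟨Or.inr hxΞ, h'⟩) (not_le.2 hx.1)
        · exact absurd (humin ⟨⟨Or.inr hxΞ, h'⟩, hx.2.le.trans hut⟩) (not_le.2 hx.2)
      · exact ih u hu h.ge
    refine (hF.abs_sub_le_max hG hu ht hut).trans (max_le hsu ?_)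
    have : (n : ℝ) * ε ≤ u := hun
    linarith

theorem unique (hF : IsBurningCDF Ξ F) (hG : IsBurningCDF Ξ G)
    (hΞ : IsClosed (insert 0 Ξ)) : F = G := by
  have key : ∀ t ∈ insert 0 Ξ, F t = G t := by
    intro t ht
    refine eq_of_abs_sub_eq_zero (le_antisymm (le_of_forall_pos_le_add fun ε hε => ?_)
      (abs_nonneg _))
    obtain ⟨n, hn⟩ := exists_nat_ge ((t : ℝ) / ε)
    rw [zero_add]
    exact hF.abs_sub_le hG hΞ hε n t ht ((div_le_iff₀ hε).1 hn)
  funext t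
  obtain ⟨s, ⟨hs, hst⟩, hsmax⟩ := (hΞ.inter (isClosed_Iic (a := t))).isCompact.exists_isGreatest
    ⟨0, Or.inl rfl, t.2.1⟩
  have hd : Disjoint (Ioc s t) Ξ := Set.disjoint_left.2 fun x hx hxΞ =>
    absurd (hsmax ⟨Or.inr hxΞ, hx.2⟩) (not_le.2 hx.1)
  rw [hF.grows s t hst hd, hG.grows s t hst hd, key s hs]

end IsBurningCDF

/-! ### The RDE in terms of distribution functions. -/

section RDE

instance : IsProbabilityMeasure unifMark := by
  unfold unifMark
  have : IsProbabilityMeasure (uniformOn (Set.univ : Set (Fin 2))) :=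
    isProbabilityMeasure_uniformOn Set.finite_univ Set.univ_nonempty
  infer_instance

theorem unifMark_real_prod_singleton (A : Set unitInterval) (k : Fin 2) :
    unifMark.real (A ×ˢ {k}) = (volume : Measure unitInterval).real A / 2 := by
  have : (uniformOn (Set.univ : Set (Fin 2))).real {k} = 1 / 2 := by
    simp [Measure.real, uniformOn_univ]
  rw [unifMark, measureReal_prod_prod, this]
  ring

theorem real_volume_Iic (t : unitInterval) : (volume : Measure unitInterval).real (Iic t) = t := by
  rw [Measure.real, unitInterval.volume_Iic, ENNReal.toReal_ofReal t.2.1]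

/-- The law of `χ[ω](Y₁, Y₂)` if `Y₁` and `Y₂` have law `ρ`. -/
def rdeMap (ρ : Measure Time) : Measure Time :=
  (unifMark.prod (ρ.prod ρ)).map (fun p => chi p.1 p.2.1 p.2.2)

/-- The distribution function on `[0,1]` of a measure on `[0,1] ∪ {∞}`. -/
def timeCDF (ρ : Measure Time) (t : unitInterval) : ℝ := ρ.real (Iic (t : Time))

variable (ρ : Measure Time) [IsProbabilityMeasure ρ]

instance : IsProbabilityMeasure (rdeMap ρ) :=
  Measure.isProbabilityMeasure_map measurable_chi.aemeasurable

theorem timeCDF_mono : Monotone (timeCDF ρ) := fun _ _ h =>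
  measureReal_mono (Iic_subset_Iic.2 (WithTop.coe_le_coe.2 h))

theorem timeCDF_sub {s t : unitInterval} (hst : s ≤ t) :
    timeCDF ρ t - timeCDF ρ s = ρ.real (Ioc (s : Time) t) := by
  have h : Iic (t : Time) = Iic (s : Time) ∪ Ioc (s : Time) t :=
    (Iic_union_Ioc_eq_Iic (WithTop.coe_le_coe.2 hst)).symm
  have hd : Disjoint (Iic (s : Time)) (Ioc (s : Time) t) :=
    Set.disjoint_left.2 fun x hx hx' => absurd hx'.1 (not_lt.2 hx)
  rw [timeCDF, timeCDF, h, measureReal_union hd measurableSet_Ioc]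
  ring

theorem real_Ioi (t : unitInterval) : ρ.real (Ioi (t : Time)) = 1 - timeCDF ρ t := by
  rw [← compl_Iic, probReal_compl_eq_one_sub measurableSet_Iic, timeCDF]

/-- The contribution to `rdeMap ρ (s, t]` of the points with two offspring. -/
theorem real_branching_Ioc {s t : unitInterval} (hst : s ≤ t) :
    (unifMark.prod (ρ.prod ρ)).real
      ((univ ×ˢ {1}) ×ˢ ((Ioi (s : Time) ×ˢ Ioi (s : Time)) \ (Ioi (t : Time) ×ˢ Ioi (t : Time)))) =
    ((1 - timeCDF ρ s) ^ 2 - (1 - timeCDF ρ t) ^ 2) / 2 := by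
  have hsub : Ioi (t : Time) ⊆ Ioi (s : Time) := Ioi_subset_Ioi (WithTop.coe_le_coe.2 hst)
  rw [measureReal_prod_prod, unifMark_real_prod_singleton,
    measureReal_sdiff (prod_mono hsub hsub) (measurableSet_Ioi.prod measurableSet_Ioi),
    measureReal_prod_prod, measureReal_prod_prod, real_Ioi, real_Ioi, probReal_univ]
  ring

/-- `J` is twice the probability that the root has one legal offspring and `τ < Y₁ ∈ (s,t]`, which
is the integral of `u` against `dF(u)`. Replacing `τ < Y₁` by `τ ≤ s` or `τ ≤ t` gives the bounds,
so no integral is needed. -/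
theorem timeCDF_rdeMap_sub {s t : unitInterval} (hst : s ≤ t) :
    ∃ J : ℝ, s * (timeCDF ρ t - timeCDF ρ s) ≤ J ∧ J ≤ t * (timeCDF ρ t - timeCDF ρ s) ∧
      2 * (timeCDF (rdeMap ρ) t - timeCDF (rdeMap ρ) s) =
        J + (timeCDF ρ t - timeCDF ρ s) * (2 - timeCDF ρ t - timeCDF ρ s) := by
  set A : Set (Mark × (Time × Time)) :=
    {p | p.1.2 = 0 ∧ (p.1.1 : Time) < p.2.1 ∧ p.2.1 ∈ Ioc (s : Time) t} with hA
  set B : Set (Mark × (Time × Time)) := (univ ×ˢ {1}) ×ˢ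
    ((Ioi (s : Time) ×ˢ Ioi (s : Time)) \ (Ioi (t : Time) ×ˢ Ioi (t : Time))) with hB
  have hBm : MeasurableSet B := (MeasurableSet.univ.prod (measurableSet_singleton _)).prod
    ((measurableSet_Ioi.prod measurableSet_Ioi).diff (measurableSet_Ioi.prod measurableSet_Ioi))
  have hpre : (fun p : Mark × (Time × Time) => chi p.1 p.2.1 p.2.2) ⁻¹' Ioc (s : Time) t
      = A ∪ B := by
    ext ⟨⟨τ, k⟩, x, y⟩
    have hk : k = 0 ∨ k = 1 := by omega
    rcases hk with rfl | rfl
    · by_cases h : (τ : Time) < x <;> simp [chi, hA, hB, h]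
    · simp only [chi, hA, hB, mem_preimage, mem_union, mem_prod, mem_sdiff, mem_Ioi, mem_Ioc]
      simp only [one_ne_zero, if_false, lt_min_iff, min_le_iff, mem_ofPred_eq, mem_univ,
        mem_singleton_iff, not_and_or, not_lt]
      tauto
  have hd : Disjoint A B := Set.disjoint_left.2 fun p hp hp' => by
    have h1 : p.1.2 = 0 := hp.1
    have h2 : p.1.2 = 1 := hp'.1.2
    rw [h1] at h2
    exact absurd h2 (by decide)
  have hJ : ∀ u : unitInterval, (unifMark.prod (ρ.prod ρ)).real
      ((Iic u ×ˢ {0}) ×ˢ (Ioc (s : Time) t ×ˢ univ)) =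
      u * (timeCDF ρ t - timeCDF ρ s) / 2 := by
    intro u
    rw [measureReal_prod_prod, unifMark_real_prod_singleton, measureReal_prod_prod, probReal_univ,
      real_volume_Iic, timeCDF_sub ρ hst]
    ring
  refine ⟨2 * (unifMark.prod (ρ.prod ρ)).real A, ?_, ?_, ?_⟩
  · have : (unifMark.prod (ρ.prod ρ)).real ((Iic s ×ˢ {0}) ×ˢ (Ioc (s : Time) t ×ˢ univ)) ≤
        (unifMark.prod (ρ.prod ρ)).real A := by
      refine measureReal_mono ?_
      rintro ⟨⟨τ, k⟩, x, y⟩ ⟨⟨h1, h2⟩, h3, -⟩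
      exact ⟨h2, (WithTop.coe_le_coe.2 h1).trans_lt h3.1, h3⟩
    rw [hJ] at this
    linarith
  · have : (unifMark.prod (ρ.prod ρ)).real A ≤
        (unifMark.prod (ρ.prod ρ)).real ((Iic t ×ˢ {0}) ×ˢ (Ioc (s : Time) t ×ˢ univ)) := by
      refine measureReal_mono ?_
      rintro ⟨⟨τ, k⟩, x, y⟩ ⟨h1, h2, h3⟩
      exact ⟨⟨WithTop.coe_le_coe.1 (h2.le.trans h3.2), h1⟩, h3, mem_univ _⟩
    rw [hJ] at this
    linarith
  · rw [timeCDF_sub _ hst, rdeMap, map_measureReal_apply measurable_chi measurableSet_Ioc, hpre,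
      measureReal_union hd hBm, real_branching_Ioc ρ hst]
    ring

theorem timeCDF_rdeMap_zero :
    timeCDF (rdeMap ρ) 0 = timeCDF ρ 0 - timeCDF ρ 0 ^ 2 / 2 := by
  have hpre : (fun p : Mark × (Time × Time) => chi p.1 p.2.1 p.2.2) ⁻¹' Iic ((0 : unitInterval) : Time)
      = (univ ×ˢ {1}) ×ˢ (Ioi ((0 : unitInterval) : Time) ×ˢ Ioi ((0 : unitInterval) : Time))ᶜ := by
    have h0 : ∀ x : Time, ((0 : unitInterval) : Time) ≤ x := fun x => by
      induction x using WithTop.recTopCoe with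
      | top => exact le_top
      | coe x => exact WithTop.coe_le_coe.2 x.2.1
    ext ⟨⟨τ, k⟩, x, y⟩
    have hk : k = 0 ∨ k = 1 := by omega
    rcases hk with rfl | rfl
    · by_cases h : (τ : Time) < x
      · have := (h0 τ).trans_lt h
        simpa [chi, h] using this.ne'
      · simp [chi, h]
    · simp only [chi, mem_preimage, mem_prod, mem_compl_iff, mem_Ioi, mem_Iic, one_ne_zero,
        if_false, min_le_iff, mem_univ, mem_singleton_iff, not_and_or, not_lt]
      tauto
  rw [timeCDF, rdeMap, map_measureReal_apply measurable_chi measurableSet_Iic, hpre,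
    measureReal_prod_prod, unifMark_real_prod_singleton,
    probReal_compl_eq_one_sub (measurableSet_Ioi.prod measurableSet_Ioi), measureReal_prod_prod,
    real_Ioi, probReal_univ]
  ring

variable {ρ}

theorem SolvesRDE.isRDECDF (h : SolvesRDE ρ) : IsRDECDF (timeCDF ρ) := by
  have h' : rdeMap ρ = ρ := h
  have hinc : ∀ s t : unitInterval, s ≤ t → (s : ℝ) * (timeCDF ρ t - timeCDF ρ s) ≤
      timeCDF ρ t ^ 2 - timeCDF ρ s ^ 2 ∧ timeCDF ρ t ^ 2 - timeCDF ρ s ^ 2 ≤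
      t * (timeCDF ρ t - timeCDF ρ s) := by
    intro s t hst
    obtain ⟨J, h1, h2, h3⟩ := timeCDF_rdeMap_sub ρ hst
    rw [h'] at h3
    constructor <;> linarith
  refine ⟨timeCDF_mono ρ, ?_, fun s t hst => (hinc s t hst).1, fun s t hst => (hinc s t hst).2⟩
  have h0 := timeCDF_rdeMap_zero ρ
  rw [h'] at h0
  exact pow_eq_zero_iff (two_ne_zero) |>.1 (by linarith)

/-- Each bisection of an interval halves the bound, since the increments of `F` add up. -/
theorem eq_zero_of_abs_sub_le {g F : unitInterval → ℝ} (h0 : g 0 = 0)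
    (h : ∀ s t : unitInterval, s ≤ t → |g t - g s| ≤ (t - s) * (F t - F s)) (t : unitInterval) :
    g t = 0 := by
  have key : ∀ (n : ℕ) (s t : unitInterval), s ≤ t →
      |g t - g s| ≤ (t - s) * (F t - F s) * (1 / 2) ^ n := by
    intro n
    induction n with
    | zero => simpa using h
    | succ n ih =>
      intro s t hst
      have hst' : (s : ℝ) ≤ t := hst
      let m : unitInterval := ⟨((s : ℝ) + t) / 2,
        by linarith [s.2.1, t.2.1], by linarith [s.2.2, t.2.2]⟩
      have hm : (m : ℝ) = ((s : ℝ) + t) / 2 := rfl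
      have h1 := ih s m (Subtype.coe_le_coe.1 (by rw [hm]; linarith))
      have h2 := ih m t (Subtype.coe_le_coe.1 (by rw [hm]; linarith))
      rw [hm] at h1 h2
      have h3 := abs_sub_le (g t) (g m) (g s)
      rw [pow_succ]
      linarith
  have hlim : Filter.Tendsto (fun n : ℕ => ((t : ℝ) - (0 : unitInterval)) * (F t - F 0) *
      (1 / 2) ^ n) Filter.atTop (nhds 0) := by
    simpa using (tendsto_pow_atTop_nhds_zero_of_lt_one (by norm_num : (0 : ℝ) ≤ 1 / 2)
      (by norm_num)).const_mul (((t : ℝ) - (0 : unitInterval)) * (F t - F 0))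
  have := ge_of_tendsto' hlim fun n => key n 0 t t.2.1
  rw [h0, sub_zero] at this
  exact abs_eq_zero.1 (le_antisymm this (abs_nonneg _))

theorem ext_of_timeCDF {ρ ρ' : Measure Time} [IsProbabilityMeasure ρ] [IsProbabilityMeasure ρ']
    (h : ∀ t, timeCDF ρ t = timeCDF ρ' t) : ρ = ρ' := by
  refine Measure.ext_of_Iic _ _ fun a => ?_
  induction a using WithTop.recTopCoe with
  | top => simp
  | coe t =>
    have := h t
    rwa [timeCDF, timeCDF, measureReal_eq_measureReal_iff] at this

/-- The increment over `(s,t]` of the difference of the two distribution functions is half the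
difference of `J` and `F t ^ 2 - F s ^ 2`, both of which lie between `s` and `t` times the increment
of `F`. -/
theorem IsRDECDF.solvesRDE (h : IsRDECDF (timeCDF ρ)) : SolvesRDE ρ := by
  refine ext_of_timeCDF (ρ := rdeMap ρ) fun t => ?_
  refine sub_eq_zero.1 (eq_zero_of_abs_sub_le (F := timeCDF ρ)
    (g := fun t => timeCDF (rdeMap ρ) t - timeCDF ρ t) ?_ (fun s t hst => ?_) t)
  · simp [timeCDF_rdeMap_zero, h.zero]
  · obtain ⟨J, h1, h2, h3⟩ := timeCDF_rdeMap_sub ρ hst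
    have h4 := h.lower s t hst
    have h5 := h.upper s t hst
    have h6 := mul_nonneg (sub_nonneg.2 (show (s : ℝ) ≤ t from hst)) (sub_nonneg.2 (h.mono hst))
    rw [abs_le]
    constructor <;> nlinarith


/-! ### From distribution functions to laws. -/

theorem measurableSet_coe_image_union_top {Ξ : Set unitInterval} (hΞ : IsClosed (insert 0 Ξ)) :
    MeasurableSet ((fun t : unitInterval => (t : Time)) '' Ξ ∪ {⊤})ᶜ := by
  have hΞm : MeasurableSet Ξ := by
    by_cases h : (0 : unitInterval) ∈ Ξ
    · rw [← insert_eq_of_mem h]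
      exact hΞ.measurableSet
    · rw [← insert_sdiff_self_of_notMem h]
      exact hΞ.measurableSet.diff (measurableSet_singleton _)
  have himg : (fun t : unitInterval => (t : Time)) '' Ξ ∪ {⊤} =
      WithTop.untopD 0 ⁻¹' Ξ ∪ {⊤} := by
    ext x
    induction x using WithTop.recTopCoe with
    | top => simp
    | coe x => simp
  rw [himg]
  exact ((WithTop.measurable_untopD 0 hΞm).union (measurableSet_singleton _)).compl

/-- The law on `[0,1] ∪ {∞}` with a given distribution function on `[0,1]`. -/
theorem exists_isBurningLaw {Ξ : Set unitInterval} (hΞ : IsClosed (insert 0 Ξ)) :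
    ∃ ρ : Measure Time, IsProbabilityMeasure ρ ∧ IsBurningLaw Ξ ρ := by
  obtain ⟨F, hF⟩ := exists_isBurningCDF Ξ
  let f : StieltjesFunction unitInterval := ⟨F, hF.mono, hF.continuousWithinAt hΞ⟩
  -- A Stieltjes measure does not charge the bottom element, which matches `F 0 = 0`.
  have hf0 : f.measure {0} = 0 := by
    have h := f.measure_botSet
    rwa [botSet_eq_singleton_of_isBot (x := (0 : unitInterval)) fun t => t.2.1] at h
  have hIoc : ∀ s t, f.measure (Ioc s t) = ENNReal.ofReal (F t - F s) := f.measure_Ioc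
  have hIic : ∀ t, f.measure (Iic t) = ENNReal.ofReal (F t) := by
    intro t
    have h : Iic t = {0} ∪ Ioc 0 t := by
      ext x
      have h0 : (0 : unitInterval) ≤ t := t.2.1
      rw [mem_Iic, singleton_union, Ioc_insert_left h0]
      exact ⟨fun h => ⟨x.2.1, h⟩, fun h => h.2⟩
    rw [h, measure_union (by simp) measurableSet_Ioc, hf0, hIoc, hF.zero]
    simp
  have hcompl : f.measure Ξᶜ = 0 := by
    have hsub : Ξᶜ ⊆ {0} ∪ (insert 0 Ξ)ᶜ := by
      intro x hx
      by_cases h : x = 0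
      · exact Or.inl h
      · exact Or.inr (by simpa [h] using hx)
    refine measure_mono_null hsub (measure_union_null hf0 ?_)
    refine measure_null_of_locally_null _ fun x hx => ?_
    obtain ⟨b, c, hxbc, hbc, hsubs⟩ :=
      exists_Icc_mem_subset_of_mem_nhds (hΞ.isOpen_compl.mem_nhds hx)
    refine ⟨Icc b c, mem_nhdsWithin_of_mem_nhds hbc, ?_⟩
    -- `a` is the left end of the gap containing `[b,c]`; a half-open interval is needed because `F`
    -- controls only those.
    obtain ⟨a, ⟨ha, hab⟩, hamax⟩ := (hΞ.inter (isClosed_Iic (a := b))).isCompact.exists_isGreatest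
      ⟨0, Or.inl rfl, b.2.1⟩
    have hbc' : b ≤ c := hxbc.1.trans hxbc.2
    have hab' : a < b := lt_of_le_of_ne hab fun h =>
      hsubs (left_mem_Icc.2 hbc') (h ▸ ha)
    refine measure_mono_null (t := Ioc a c) (fun y hy => ⟨hab'.trans_le hy.1, hy.2⟩) ?_
    rw [hIoc, hF.grows a c (hab.trans hbc') (Set.disjoint_left.2 fun y hy hyΞ => ?_), sub_self,
      ENNReal.ofReal_zero]
    rcases le_total y b with h | h
    · exact absurd (hamax ⟨Or.inr hyΞ, h⟩) (not_le.2 hy.1)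
    · exact hsubs ⟨h, hy.2⟩ (Or.inr hyΞ)
  have hF1 : F 1 ≤ 1 := by simpa using hF.le_coe 1
  let ρ : Measure Time := f.measure.map (fun t : unitInterval => (t : Time)) +
    ENNReal.ofReal (1 - F 1) • Measure.dirac ⊤
  have hρ : ∀ A : Set Time, MeasurableSet A → ⊤ ∉ A →
      ρ A = f.measure ((fun t : unitInterval => (t : Time)) ⁻¹' A) := by
    intro A hA hA'
    simp only [ρ, Measure.add_apply, Measure.smul_apply]
    rw [Measure.map_apply WithTop.measurable_coe hA, Measure.dirac_apply' _ hA]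
    simp [hA']
  have hprob : IsProbabilityMeasure ρ := by
    constructor
    simp only [ρ, Measure.add_apply, Measure.smul_apply]
    rw [Measure.map_apply WithTop.measurable_coe MeasurableSet.univ, measure_univ, preimage_univ,
      ← Iic_top, show (⊤ : unitInterval) = 1 from rfl, hIic, smul_eq_mul, mul_one,
      ← ENNReal.ofReal_add (hF.nonneg 1) (by linarith)]
    simp
  have hcdf : ∀ t : unitInterval, ρ (Iic (t : Time)) = ENNReal.ofReal (F t) := by
    intro t
    rw [hρ _ measurableSet_Iic (by simp), ← hIic]
    congr 1
    ext x
    simp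
  have hcdf' : timeCDF ρ = F := by
    funext t
    rw [timeCDF, Measure.real, hcdf, ENNReal.toReal_ofReal (hF.nonneg t)]
  refine ⟨ρ, hprob, IsRDECDF.solvesRDE (hcdf' ▸ hF.toIsRDECDF), ?_, fun t ht => ?_⟩
  · rw [hρ _ (measurableSet_coe_image_union_top hΞ) (by simp)]
    convert hcompl using 2
    ext x
    simp
  · rw [hcdf]
    exact ENNReal.ofReal_le_ofReal (hF.half_le t ht)

theorem IsBurningLaw.isBurningCDF {Ξ : Set unitInterval} (h : IsBurningLaw Ξ ρ) :
    IsBurningCDF Ξ (timeCDF ρ) := by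
  refine ⟨h.rde.isRDECDF, fun s t hst hd => ?_, fun t ht => ?_⟩
  · refine sub_eq_zero.1 ?_
    rw [timeCDF_sub ρ hst, measureReal_eq_zero_iff]
    refine measure_mono_null ?_ h.concentrated
    rintro x hx (⟨u, hu, rfl⟩ | rfl)
    · exact Set.disjoint_left.1 hd ⟨WithTop.coe_lt_coe.1 hx.1, WithTop.coe_le_coe.1 hx.2⟩ hu
    · exact absurd hx.2 (by simp)
  · exact (ENNReal.ofReal_le_iff_le_toReal (measure_ne_top _ _)).1 (h.half_le t ht)

theorem IsBurningLaw.unique {Ξ : Set unitInterval} (hΞ : IsClosed (insert 0 Ξ))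
    {ρ' : Measure Time} [IsProbabilityMeasure ρ'] (h : IsBurningLaw Ξ ρ)
    (h' : IsBurningLaw Ξ ρ') : ρ = ρ' :=
  ext_of_timeCDF fun t => congrFun (h.isBurningCDF.unique h'.isBurningCDF hΞ) t

end RDE

/-! ### Legal paths and König's lemma. -/

/-- There is a legal upwards path of length `n` that starts at `i` and all of whose points, except
possibly for the last one, lie in `A`. -/
def ReachesDepth (w : Word → Mark) (A : Set Word) : ℕ → Word → Prop
  | 0, _ => True
  | n + 1, i => i ∈ A ∧ ∃ j : Fin 2, j ≤ (w i).2 ∧ ReachesDepth w A n (i ++ [j])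

section Paths

variable {w : Word → Mark} {A : Set Word}

theorem ReachesDepth.of_succ : ∀ {n : ℕ} {i : Word},
    ReachesDepth w A (n + 1) i → ReachesDepth w A n i
  | 0, _, _ => trivial
  | _ + 1, _, ⟨hi, j, hj, h⟩ => ⟨hi, j, hj, h.of_succ⟩

theorem ReachesDepth.of_le {m n : ℕ} (hmn : m ≤ n) {i : Word} (h : ReachesDepth w A n i) :
    ReachesDepth w A m i := by
  induction hmn with
  | refl => exact h
  | step _ ih => exact ih h.of_succ

theorem reachesDepth_forall_step {i : Word} (h : ∀ n, ReachesDepth w A n i) :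
    i ∈ A ∧ ∃ j : Fin 2, j ≤ (w i).2 ∧ ∀ n, ReachesDepth w A n (i ++ [j]) := by
  refine ⟨(h 1).1, ?_⟩
  by_contra! hno
  have hex : ∀ j : Fin 2, ∃ n, j ≤ (w i).2 → ¬ ReachesDepth w A n (i ++ [j]) := by
    intro j
    by_cases hj : j ≤ (w i).2
    · obtain ⟨n, hn⟩ := hno j hj
      exact ⟨n, fun _ => hn⟩
    · exact ⟨0, fun h => absurd h hj⟩
  choose m hm using hex
  obtain ⟨-, j, hj, hr⟩ := h (max (m 0) (m 1) + 1)
  refine hm j hj (hr.of_le ?_)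
  have hk : j = 0 ∨ j = 1 := by omega
  rcases hk with rfl | rfl
  · exact le_max_left _ _
  · exact le_max_right _ _

theorem Percolates.step {i : Word} (h : Percolates w A i) :
    i ∈ A ∧ ∃ j : Fin 2, j ≤ (w i).2 ∧ Percolates w A (i ++ [j]) := by
  obtain ⟨j, hj⟩ := h
  refine ⟨by simpa using (hj 0).2, j 0, by simpa using (hj 0).1, fun k => j (k + 1), fun k => ?_⟩
  have := hj (k + 1)
  rw [List.range_succ_eq_map] at this
  simpa [List.map_map, Function.comp_def] using this

/-- The path obtained by repeatedly adding the letter selected by `f`. -/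
def followPath (f : Word → Fin 2) (i : Word) : ℕ → Word
  | 0 => i
  | k + 1 => followPath f i k ++ [f (followPath f i k)]

theorem followPath_eq (f : Word → Fin 2) (i : Word) (k : ℕ) :
    i ++ (List.range k).map (fun m => f (followPath f i m)) = followPath f i k := by
  induction k with
  | zero => simp [followPath]
  | succ k ih => rw [List.range_succ, List.map_append, ← List.append_assoc, ih]; rfl

/-- König's lemma for the legal upwards paths. -/
theorem percolates_iff_forall_reachesDepth {i : Word} :
    Percolates w A i ↔ ∀ n, ReachesDepth w A n i := by
  constructor
  · intro h n
    induction n generalizing i with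
    | zero => trivial
    | succ n ih =>
      obtain ⟨hi, j, hj, hp⟩ := h.step
      exact ⟨hi, j, hj, ih hp⟩
  · intro h
    have hex : ∀ i : Word, ∃ j : Fin 2, (∀ n, ReachesDepth w A n i) →
        i ∈ A ∧ j ≤ (w i).2 ∧ ∀ n, ReachesDepth w A n (i ++ [j]) := by
      intro i
      by_cases hi : ∀ n, ReachesDepth w A n i
      · obtain ⟨h1, j, h2, h3⟩ := reachesDepth_forall_step hi
        exact ⟨j, fun _ => ⟨h1, h2, h3⟩⟩
      · exact ⟨0, fun h => absurd h hi⟩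
    choose f hf using hex
    have hall : ∀ k n, ReachesDepth w A n (followPath f i k) := by
      intro k
      induction k with
      | zero => exact h
      | succ k ih => exact (hf _ ih).2.2
    refine ⟨fun m => f (followPath f i m), fun k => ?_⟩
    rw [followPath_eq]
    exact ⟨(hf _ (hall k)).2.1, (hf _ (hall k)).1⟩

theorem percolates_iff_step {i : Word} :
    Percolates w A i ↔ i ∈ A ∧ ∃ j : Fin 2, j ≤ (w i).2 ∧ Percolates w A (i ++ [j]) := by
  refine ⟨Percolates.step, fun ⟨hi, j, hj, h⟩ => percolates_iff_forall_reachesDepth.2 fun n => ?_⟩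
  cases n with
  | zero => trivial
  | succ n => exact ⟨hi, j, hj, percolates_iff_forall_reachesDepth.1 h n⟩

theorem Percolates.mono {B : Set Word} (hAB : A ⊆ B) {i : Word} (h : Percolates w A i) :
    Percolates w B i :=
  h.imp fun _ hj k => ⟨(hj k).1, hAB (hj k).2⟩

end Paths

/-! ### The recursion for the burning times. -/

section Deterministic

variable {Ξ : Set unitInterval} {w : Word → Mark} {F : Set Word}

theorem activated_mono (w : Word → Mark) : Monotone (activated w) := by
  rintro s t hst i (h | h)
  · exact Or.inl ⟨h.1, h.2.trans hst⟩
  · exact Or.inr h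

theorem Percolates.mono_time {s t : unitInterval} (hst : s ≤ t) {i : Word}
    (h : Percolates w (activated w s \ F) i) : Percolates w (activated w t \ F) i :=
  h.mono (sdiff_subset_sdiff_left (activated_mono w hst))

/-- By König's lemma this is an intersection over depths of finite combinations of conditions `τ ≤
t`. Closedness is what makes the infimum in the burning time attained. -/
theorem isClosed_setOf_percolates (w : Word → Mark) (F : Set Word) (i : Word) :
    IsClosed {t | Percolates w (activated w t \ F) i} := by
  simp only [percolates_iff_forall_reachesDepth, ofPred_forall]
  refine isClosed_iInter fun n => ?_
  induction n generalizing i with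
  | zero => simp [ReachesDepth]
  | succ n ih =>
    have h : {t | ReachesDepth w (activated w t \ F) (n + 1) i} =
        (({_t | (w i).2 = 0} ∩ {t | (w i).1 ≤ t} ∪ {_t | (w i).2 = 1}) ∩ {_t | i ∉ F}) ∩
          ⋃ j : Fin 2, {_t | j ≤ (w i).2} ∩
            {t | ReachesDepth w (activated w t \ F) n (i ++ [j])} := by
      ext t
      simp [ReachesDepth, activated]
    rw [h]
    refine IsClosed.inter (IsClosed.inter (IsClosed.union (IsClosed.inter isClosed_const ?_)
      isClosed_const) isClosed_const) ?_
    · exact isClosed_Ici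
    · exact isClosed_iUnion_of_finite fun j => isClosed_const.inter (ih _)

theorem burningTime_lt_iff {i : Word} {a : Time} :
    burningTime Ξ w F i < a ↔ ∃ t ∈ Ξ, (t : Time) < a ∧ Percolates w (activated w t \ F) i := by
  rw [burningTime, sInf_lt_iff]
  constructor
  · rintro ⟨_, ⟨t, ⟨ht, hp⟩, rfl⟩, hlt⟩
    exact ⟨t, ht, hlt, hp⟩
  · rintro ⟨t, ht, hlt, hp⟩
    exact ⟨_, ⟨t, ⟨ht, hp⟩, rfl⟩, hlt⟩

theorem burningTime_le {i : Word} {t : unitInterval} (ht : t ∈ Ξ)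
    (hp : Percolates w (activated w t \ F) i) : burningTime Ξ w F i ≤ t :=
  sInf_le ⟨t, ⟨ht, hp⟩, rfl⟩

theorem le_burningTime_iff {i : Word} {a : Time} :
    a ≤ burningTime Ξ w F i ↔ ∀ t ∈ Ξ, Percolates w (activated w t \ F) i → a ≤ t := by
  rw [burningTime, le_sInf_iff]
  constructor
  · exact fun h t ht hp => h _ ⟨t, ⟨ht, hp⟩, rfl⟩
  · rintro h _ ⟨t, ⟨ht, hp⟩, rfl⟩
    exact h t ht hp

/-- The infimum in the definition of the burning time is attained, unless it is zero. -/
theorem mem_and_percolates_of_burningTime_eq (hΞ : IsClosed (insert 0 Ξ)) {i : Word}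
    {y : unitInterval} (hy : burningTime Ξ w F i = y) :
    y ∈ insert 0 Ξ ∧ Percolates w (activated w y \ F) i := by
  set T := {t ∈ Ξ | Percolates w (activated w t \ F) i} with hT
  have hne : T.Nonempty := by
    have : burningTime Ξ w F i < ⊤ := hy ▸ WithTop.coe_lt_top y
    obtain ⟨t, ht, -, hp⟩ := burningTime_lt_iff.1 this
    exact ⟨t, ht, hp⟩
  have hglb : IsGLB T y := by
    refine ⟨fun t ht => ?_, fun u hu => ?_⟩
    · exact WithTop.coe_le_coe.1 (hy ▸ burningTime_le ht.1 ht.2)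
    · exact WithTop.coe_le_coe.1 (hy ▸ le_burningTime_iff.2 fun t ht hp =>
        WithTop.coe_le_coe.2 (hu ⟨ht, hp⟩))
  have hcl : IsClosed (insert 0 Ξ ∩ {t | Percolates w (activated w t \ F) i}) :=
    hΞ.inter (isClosed_setOf_percolates w F i)
  have hsub : T ⊆ insert 0 Ξ ∩ {t | Percolates w (activated w t \ F) i} := by
    rintro t ⟨ht, hp⟩
    exact ⟨Or.inr ht, hp⟩
  exact closure_minimal hsub hcl (hglb.mem_closure hne)

theorem fin_two_le_zero {j : Fin 2} : j ≤ 0 ↔ j = 0 := by omega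

/-- The recursion satisfied by the burning times. -/
theorem burningTime_eq_chi (hΞ : IsClosed (insert 0 Ξ)) (h0 : (0 : unitInterval) ∉ Ξ)
    (hF : FrozenEq Ξ w F) {i : Word}
    (hi : 0 < (w i).1) : burningTime Ξ w F i =
      chi (w i) (burningTime Ξ w F (i ++ [0])) (burningTime Ξ w F (i ++ [1])) := by
  have hk : (w i).2 = 0 ∨ (w i).2 = 1 := by omega
  rcases hk with hk | hk
  · rw [chi, if_pos hk]
    have hstep : ∀ t, Percolates w (activated w t \ F) i ↔ (w i).1 ≤ t ∧ i ∉ F ∧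
        Percolates w (activated w t \ F) (i ++ [0]) := by
      intro t
      rw [percolates_iff_step, hk]
      simp only [fin_two_le_zero, exists_eq_left, mem_sdiff]
      simp only [activated, mem_ofPred_eq, hk, true_and, and_assoc]
      simp
    split_ifs with hlt
    · have hiF : i ∉ F := by
        rw [hF i]
        rintro ⟨-, t, ht, -, hti, hp⟩
        exact absurd hlt (not_lt.2 ((burningTime_le ht hp).trans (WithTop.coe_le_coe.2 hti)))
      refine le_antisymm ?_ ?_
      · refine le_burningTime_iff.2 fun t ht hp => burningTime_le ht ?_
        have hti : (w i).1 ≤ t :=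
          WithTop.coe_le_coe.1 (hlt.le.trans (burningTime_le ht hp))
        exact (hstep t).2 ⟨hti, hiF, hp⟩
      · exact le_burningTime_iff.2 fun t ht hp => burningTime_le ht ((hstep t).1 hp).2.2
    · have hiF : i ∈ F := by
        obtain ⟨y, hy⟩ := WithTop.ne_top_iff_exists.1
          (ne_top_of_le_ne_top WithTop.coe_ne_top (not_lt.1 hlt))
        obtain ⟨hyΞ, hp⟩ := mem_and_percolates_of_burningTime_eq hΞ hy.symm
        have hyi : y ≤ (w i).1 := WithTop.coe_le_coe.1 (hy ▸ not_lt.1 hlt)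
        rw [hF i]
        refine ⟨hk, ?_⟩
        -- If the infimum is `0`, which is not in `Ξ`, then `0 < τ` leaves room for a percolation
        -- time in `Ξ` below `τ`.
        rcases hyΞ with rfl | hyΞ
        · have hlt' : burningTime Ξ w F (i ++ [0]) < ((w i).1 : Time) := by
            rw [← hy]
            exact WithTop.coe_lt_coe.2 hi
          obtain ⟨t, ht, hti, hp'⟩ := burningTime_lt_iff.1 hlt'
          exact ⟨t, ht, lt_of_le_of_ne t.2.1 fun h => h0 (h ▸ ht), (WithTop.coe_lt_coe.1 hti).le,
            hp'⟩
        · exact ⟨y, hyΞ, lt_of_le_of_ne y.2.1 fun h => h0 (h ▸ hyΞ), hyi, hp⟩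
      refine top_le_iff.1 (le_burningTime_iff.2 fun t ht hp => absurd hiF ((hstep t).1 hp).2.1)
  · rw [chi, if_neg (by rw [hk]; decide)]
    have hiF : i ∉ F := by
      rw [hF i, hk]
      rintro ⟨h, -⟩
      exact absurd h (by decide)
    have hstep : ∀ t, Percolates w (activated w t \ F) i ↔
        Percolates w (activated w t \ F) (i ++ [0]) ∨
        Percolates w (activated w t \ F) (i ++ [1]) := by
      intro t
      rw [percolates_iff_step, hk]
      have : i ∈ activated w t \ F := ⟨Or.inr hk, hiF⟩
      simp [this, Fin.exists_fin_two]
    refine le_antisymm (le_min ?_ ?_) ?_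
    · exact le_burningTime_iff.2 fun t ht hp => burningTime_le ht ((hstep t).2 (Or.inl hp))
    · exact le_burningTime_iff.2 fun t ht hp => burningTime_le ht ((hstep t).2 (Or.inr hp))
    · refine le_burningTime_iff.2 fun t ht hp => ?_
      rcases (hstep t).1 hp with h | h
      · exact (min_le_left _ _).trans (burningTime_le ht h)
      · exact (min_le_right _ _).trans (burningTime_le ht h)

end Deterministic

/-! ### Measurability on the space of realisations. -/

/-- The realisations of the marks together with a set of points. -/
abbrev Realisation := (Word → Mark) × Set Word

/-- The realisation `x`, seen from the point `j`. -/
def Realisation.shift (j : Word) (x : Realisation) : Realisation :=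
  (fun i => x.1 (j ++ i), {i | j ++ i ∈ x.2})

/-- The burning time of the root. -/
def rootTime (Ξ : Set unitInterval) (x : Realisation) : Time := burningTime Ξ x.1 x.2 []

theorem rootTime_shift (Ξ : Set unitInterval) (x : Realisation) (j : Word) :
    rootTime Ξ (x.shift j) = burningTime Ξ x.1 x.2 j := by
  rw [rootTime, burningTime, burningTime]
  congr 2

theorem measurable_shift (j : Word) : Measurable (Realisation.shift j) := by
  refine Measurable.prodMk ?_ ?_
  · exact measurable_pi_iff.2 fun i => (measurable_pi_apply (j ++ i)).comp measurable_fst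
  · exact measurable_set_iff.2 fun i => (measurable_set_mem (j ++ i)).comp measurable_snd

theorem measurable_mark (i : Word) : Measurable fun x : Realisation => x.1 i :=
  (measurable_pi_apply i).comp measurable_fst

theorem measurableSet_percolates (t : unitInterval) (i : Word) :
    MeasurableSet {x : Realisation | Percolates x.1 (activated x.1 t \ x.2) i} := by
  simp only [percolates_iff_forall_reachesDepth, ofPred_forall]
  refine MeasurableSet.iInter fun n => ?_
  induction n generalizing i with
  | zero => simp [ReachesDepth]
  | succ n ih =>
    have h : {x : Realisation | ReachesDepth x.1 (activated x.1 t \ x.2) (n + 1) i} =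
        (((fun x : Realisation => x.1 i) ⁻¹' {m | (m.2 = 0 ∧ m.1 ≤ t) ∨ m.2 = 1}) ∩
          {x : Realisation | i ∈ x.2}ᶜ) ∩
          ⋃ j : Fin 2, ((fun x : Realisation => x.1 i) ⁻¹' {m | j ≤ m.2}) ∩
            {x | ReachesDepth x.1 (activated x.1 t \ x.2) n (i ++ [j])} := by
      ext t
      simp [ReachesDepth, activated]
    rw [h]
    refine MeasurableSet.inter (MeasurableSet.inter (measurable_mark i ?_) ?_)
      (MeasurableSet.iUnion fun j => (measurable_mark i ?_).inter (ih _))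
    · refine MeasurableSet.union (MeasurableSet.inter ?_ ?_) ?_
      · exact measurable_snd (measurableSet_singleton (0 : Fin 2))
      · exact measurable_fst measurableSet_Iic
      · exact measurable_snd (measurableSet_singleton (1 : Fin 2))
    · exact MeasurableSet.compl
        (measurableSet_setOfPred.2 ((measurable_set_mem i).comp measurable_snd))
    · exact measurable_snd measurableSet_Ici

theorem exists_countable_cofinal (T : Set unitInterval) :
    ∃ C ⊆ T, C.Countable ∧ ∀ t ∈ T, ∃ c ∈ C, t ≤ c := by
  rcases T.eq_empty_or_nonempty with rfl | hne
  · exact ⟨∅, Subset.rfl, countable_empty, by simp⟩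
  by_cases hs : sSup T ∈ T
  · exact ⟨{sSup T}, singleton_subset_iff.2 hs, countable_singleton _,
      fun t ht => ⟨_, rfl, le_sSup ht⟩⟩
  · obtain ⟨u, -, -, hu, huT⟩ := (isLUB_sSup T).exists_seq_monotone_tendsto hne
    refine ⟨range u, range_subset_iff.2 huT, countable_range u, fun t ht => ?_⟩
    have hlt : t < sSup T := lt_of_le_of_ne (le_sSup ht) fun h => hs (h ▸ ht)
    obtain ⟨n, hn⟩ := (hu.eventually (lt_mem_nhds hlt)).exists
    exact ⟨u n, mem_range_self n, hn.le⟩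

/-- Percolation is monotone in time, so a countable cofinal set of times below `a` suffices. -/
theorem measurable_rootTime (Ξ : Set unitInterval) : Measurable (rootTime Ξ) := by
  refine measurable_of_Iio fun a => ?_
  obtain ⟨C, hC, hCc, hcof⟩ := exists_countable_cofinal {t ∈ Ξ | (t : Time) < a}
  have h : rootTime Ξ ⁻¹' Iio a =
      ⋃ t ∈ C, {x : Realisation | Percolates x.1 (activated x.1 t \ x.2) []} := by
    ext x
    simp only [mem_preimage, mem_Iio, rootTime, burningTime_lt_iff, mem_iUnion, mem_ofPred_eq,
      exists_prop]
    constructor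
    · rintro ⟨t, ht, hta, hp⟩
      obtain ⟨c, hc, htc⟩ := hcof t ⟨ht, hta⟩
      exact ⟨c, hc, hp.mono_time htc⟩
    · rintro ⟨t, ht, hp⟩
      exact ⟨t, (hC ht).1, (hC ht).2, hp⟩
  rw [h]
  exact MeasurableSet.biUnion hCc fun t _ => measurableSet_percolates t []

/-! ### The tree of unburnt points. -/

section Deterministic

variable (Ξ : Set unitInterval) (t : unitInterval)

/-- The realisations for which the root has not burnt by time `t`. -/
def unburnt : Set Realisation := {x | (t : Time) < rootTime Ξ x}

/-- The realisations for which there is an upwards path of length `n` that starts at the root,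
consists of points that have not burnt by time `t`, and whose points, except possibly for the last
one, are activated by time `t`. -/
def unburntPath : ℕ → Set Realisation
  | 0 => unburnt Ξ t
  | n + 1 => unburnt Ξ t ∩
      ({x | (x.1 []).2 = 1 ∧ (x.shift [0] ∈ unburnt Ξ t ∧ x.shift [1] ∈ unburnt Ξ t) ∧
          (x.shift [0] ∈ unburntPath n ∨ x.shift [1] ∈ unburntPath n)} ∪
        {x | (x.1 []).2 = 0 ∧ (x.1 []).1 ≤ t ∧ x.shift [0] ∈ unburntPath n})

variable {Ξ t}

theorem unburntPath_subset_unburnt : ∀ n, unburntPath Ξ t n ⊆ unburnt Ξ t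
  | 0 => Subset.rfl
  | _ + 1 => inter_subset_left

theorem unburntPath_antitone : Antitone (unburntPath Ξ t) := by
  refine antitone_nat_of_succ_le fun n => ?_
  induction n with
  | zero => exact inter_subset_left
  | succ n ih =>
    refine inter_subset_inter_right _ (union_subset_union ?_ ?_)
    · exact fun x hx => ⟨hx.1, hx.2.1, hx.2.2.imp (fun h => ih h) (fun h => ih h)⟩
    · exact fun x hx => ⟨hx.1, hx.2.1, ih hx.2.2⟩

theorem measurableSet_unburnt : MeasurableSet (unburnt Ξ t) :=
  measurable_rootTime Ξ measurableSet_Ioi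

theorem measurableSet_unburntPath (n : ℕ) : MeasurableSet (unburntPath Ξ t n) := by
  induction n with
  | zero => exact measurableSet_unburnt
  | succ n ih =>
    have hk : ∀ k : Fin 2, MeasurableSet {x : Realisation | (x.1 []).2 = k} := fun k =>
      (measurable_snd.comp (measurable_mark [])) (measurableSet_singleton k)
    have hτ : MeasurableSet {x : Realisation | (x.1 []).1 ≤ t} :=
      (measurable_fst.comp (measurable_mark [])) measurableSet_Iic
    have hL : ∀ j, MeasurableSet {x : Realisation | x.shift j ∈ unburnt Ξ t} := fun j =>
      measurable_shift j measurableSet_unburnt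
    have hD : ∀ j, MeasurableSet {x : Realisation | x.shift j ∈ unburntPath Ξ t n} := fun j =>
      measurable_shift j ih
    exact measurableSet_unburnt.inter
      (((hk 1).inter (((hL _).inter (hL _)).inter ((hD _).union (hD _)))).union
        ((hk 0).inter (hτ.inter (hD _))))

theorem shift_shift (i j : Word) (x : Realisation) : (x.shift i).shift j = x.shift (i ++ j) := by
  simp [Realisation.shift]

/-- A frozen point with `τ ≤ t` has an offspring that burns by time `τ`, so it cannot precede an
unburnt point on the path. -/
theorem reachesDepth_of_mem_unburntPath {x : Realisation}
    (hx : FrozenEq Ξ x.1 x.2) {n : ℕ} : ∀ {i : Word}, x.shift i ∈ unburntPath Ξ t n →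
      ReachesDepth x.1 (activated x.1 t \ x.2) n i := by
  induction n with
  | zero => exact fun _ => trivial
  | succ n ih =>
    rintro i ⟨-, h⟩
    simp only [mem_union, mem_ofPred_eq, shift_shift] at h
    have hi : (x.shift i).1 [] = x.1 i := by simp [Realisation.shift]
    rw [hi] at h
    rcases h with ⟨hk, -, h⟩ | ⟨hk, hτ, h⟩
    · have hiA : i ∈ activated x.1 t \ x.2 := by
        refine ⟨Or.inr hk, fun hiF => ?_⟩
        have := ((hx i).1 hiF).1
        rw [hk] at this
        exact absurd this (by decide)
      rcases h with h | h
      · exact ⟨hiA, 0, Fin.zero_le _, ih h⟩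
      · exact ⟨hiA, 1, hk.ge, ih h⟩
    · refine ⟨⟨Or.inl ⟨hk, hτ⟩, fun hiF => ?_⟩, 0, Fin.zero_le _, ih h⟩
      obtain ⟨-, s, hs, -, hsτ, hp⟩ := (hx i).1 hiF
      have hlt : (t : Time) < rootTime Ξ (x.shift (i ++ [0])) := unburntPath_subset_unburnt n h
      rw [rootTime_shift] at hlt
      exact absurd ((burningTime_le hs hp).trans (WithTop.coe_le_coe.2 (hsτ.trans hτ)))
        (not_le.2 hlt)

theorem notMem_iInter_unburntPath (ht : t ∈ Ξ) {x : Realisation} (hx : FrozenEq Ξ x.1 x.2) :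
    x ∉ ⋂ n, unburntPath Ξ t n := by
  intro h
  rw [mem_iInter] at h
  have hp : Percolates x.1 (activated x.1 t \ x.2) [] :=
    percolates_iff_forall_reachesDepth.2 fun n => reachesDepth_of_mem_unburntPath hx (h n)
  exact absurd (burningTime_le ht hp) (not_le.2 (h 0))

end Deterministic

/-! ### The law of the burning time of the root. -/

section Random

variable {S : Type*} [MeasurableSpace S] {P : Measure S}
  {ω : Word → S → Mark} {F : S → Set Word} {Ξ : Set unitInterval}

theorem measurable_shifted (hω : IsUniformMarking P ω) (hF : Measurable F) (j : Word) :
    Measurable (shifted ω F j) := by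
  have h : Measurable fun s => ((fun i => ω i s, F s) : Realisation) :=
    (measurable_pi_iff.2 hω.measurable).prodMk hF
  exact (measurable_shift j).comp h

/-- The mark of the root and the realisations seen from its two offspring are independent. -/
theorem map_mark_shifted [IsProbabilityMeasure P] (hω : IsUniformMarking P ω) (hF : Measurable F)
    (hs : IsStationary P ω F) (ha : IsAdapted P ω F) (hr : RespectsTree P ω F) :
    P.map (fun s => (ω [] s, (shifted ω F [0] s, shifted ω F [1] s))) =
      unifMark.prod ((P.map (shifted ω F [])).prod (P.map (shifted ω F []))) := by
  have hU : IsRootedSubtree {([] : Word)} := fun i hi hne => absurd hi hne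
  have hmem : ∀ j : Fin 2, [j] ∈ boundary {([] : Word)} := fun j => Or.inr (by simp)
  have hm := measurable_shifted hω hF
  have hind := (hr _ (finite_singleton _) hU).indepFun
    (show (⟨[0], hmem 0⟩ : boundary {([] : Word)}) ≠ ⟨[1], hmem 1⟩ by simp)
  have hind' : IndepFun (fun s => (shifted ω F [0] s, shifted ω F [1] s)) (ω []) P :=
    (ha _ (finite_singleton _) hU).comp
      (φ := fun g => (g ⟨[0], hmem 0⟩, g ⟨[1], hmem 1⟩)) (ψ := fun g => g ⟨[], rfl⟩)
      (by fun_prop) (by fun_prop)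
  rw [(indepFun_iff_map_prod_eq_prod_map_map (hω.measurable []).aemeasurable
    ((hm [0]).prodMk (hm [1])).aemeasurable).1 hind'.symm, hω.law,
    (indepFun_iff_map_prod_eq_prod_map_map (hm [0]).aemeasurable (hm [1]).aemeasurable).1 hind,
    (hs [0] []).map_eq, (hs [1] []).map_eq]

theorem ae_mark_pos (hω : IsUniformMarking P ω) (i : Word) : ∀ᵐ s ∂P, 0 < (ω i s).1 := by
  have h0 : unifMark ({0} ×ˢ univ) = 0 := by
    rw [unifMark, Measure.prod_prod]
    simp
  rw [← hω.law i, Measure.map_apply (hω.measurable i)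
    ((measurableSet_singleton _).prod MeasurableSet.univ)] at h0
  refine measure_mono_null (fun s hs => ?_) h0
  have : ¬ 0 < (ω i s).1 := hs
  exact ⟨le_antisymm (not_lt.1 this) (ω i s).1.2.1, mem_univ _⟩

theorem ae_rootTime_eq_chi (hΞ : IsClosed (insert 0 Ξ)) (h0 : (0 : unitInterval) ∉ Ξ)
    (hω : IsUniformMarking P ω) (hfr : ∀ᵐ s ∂P, FrozenEq Ξ (fun i => ω i s) (F s)) :
    ∀ᵐ s ∂P, rootTime Ξ (shifted ω F [] s) =
      chi (ω [] s) (rootTime Ξ (shifted ω F [0] s)) (rootTime Ξ (shifted ω F [1] s)) := by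
  filter_upwards [ae_mark_pos hω [], hfr] with s hs hf
  have h := rootTime_shift Ξ (fun i => ω i s, F s)
  exact (h []).trans ((burningTime_eq_chi hΞ h0 hf hs).trans
    (congrArg₂ (chi (ω [] s)) (h [0]).symm (h [1]).symm))

theorem solvesRDE_map_rootTime [IsProbabilityMeasure P]
    (hΞ : IsClosed (insert 0 Ξ)) (h0 : (0 : unitInterval) ∉ Ξ)
    (hω : IsUniformMarking P ω) (hF : Measurable F)
    (hfr : ∀ᵐ s ∂P, FrozenEq Ξ (fun i => ω i s) (F s))
    (hs : IsStationary P ω F) (ha : IsAdapted P ω F) (hr : RespectsTree P ω F) :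
    SolvesRDE (P.map fun s => rootTime Ξ (shifted ω F [] s)) := by
  have hm := measurable_shifted hω hF
  have hY := measurable_rootTime Ξ
  have hYm : ∀ j, Measurable fun s => rootTime Ξ (shifted ω F j s) := fun j => hY.comp (hm j)
  have hprod : (unifMark.prod ((P.map fun s => rootTime Ξ (shifted ω F [] s)).prod
      (P.map fun s => rootTime Ξ (shifted ω F [] s)))) =
      P.map fun s => (ω [] s, rootTime Ξ (shifted ω F [0] s), rootTime Ξ (shifted ω F [1] s)) := by
    have : IsProbabilityMeasure (P.map (shifted ω F [])) :=
      Measure.isProbabilityMeasure_map (hm []).aemeasurable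
    have h1 : (P.map fun s => rootTime Ξ (shifted ω F [] s)) =
        (P.map (shifted ω F [])).map (rootTime Ξ) := (Measure.map_map hY (hm [])).symm
    have h2 : unifMark.map id = unifMark := Measure.map_id
    rw [h1, Measure.map_prod_map _ _ hY hY]
    conv_lhs => rw [← h2]
    rw [Measure.map_prod_map _ _ measurable_id (hY.prodMap hY), ← map_mark_shifted hω hF hs ha hr,
      Measure.map_map (measurable_id.prodMap (hY.prodMap hY))
        ((hω.measurable []).prodMk ((hm [0]).prodMk (hm [1])))]
    rfl
  rw [SolvesRDE, hprod, Measure.map_map measurable_chi ((hω.measurable []).prodMk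
    ((hYm [0]).prodMk (hYm [1])))]
  exact Measure.map_congr ((ae_rootTime_eq_chi hΞ h0 hω hfr).mono fun s h => h.symm)

/-- If the law of the burning time of the root violated the lower bound at `t`, then the tree of
the unburnt points would be a supercritical branching process. -/
theorem half_le_timeCDF [IsProbabilityMeasure P]
    (hΞ : IsClosed (insert 0 Ξ)) (h0 : (0 : unitInterval) ∉ Ξ)
    (hω : IsUniformMarking P ω) (hF : Measurable F)
    (hfr : ∀ᵐ s ∂P, FrozenEq Ξ (fun i => ω i s) (F s))
    (hs : IsStationary P ω F) (ha : IsAdapted P ω F) (hr : RespectsTree P ω F)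
    {t : unitInterval} (ht : t ∈ Ξ) :
    (t : ℝ) / 2 ≤ timeCDF (P.map fun s => rootTime Ξ (shifted ω F [] s)) t := by
  have hm := measurable_shifted hω hF
  have hY := measurable_rootTime Ξ
  have hYm : Measurable fun s => rootTime Ξ (shifted ω F [] s) := hY.comp (hm [])
  set q := timeCDF (P.map fun s => rootTime Ξ (shifted ω F [] s)) t with hq
  set ν := P.map (shifted ω F []) with hν
  have hνp : IsProbabilityMeasure ν := Measure.isProbabilityMeasure_map (hm []).aemeasurable
  have hρp : IsProbabilityMeasure (P.map fun s => rootTime Ξ (shifted ω F [] s)) :=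
    Measure.isProbabilityMeasure_map hYm.aemeasurable
  by_contra! hlt
  have hq0 : 0 ≤ q := measureReal_nonneg
  have ht1 : (t : ℝ) ≤ 1 := t.2.2
  have hL : ν.real (unburnt Ξ t) = 1 - q := by
    rw [hq, ← real_Ioi, map_measureReal_apply hYm measurableSet_Ioi, hν,
      map_measureReal_apply (hm []) measurableSet_unburnt]
    rfl
  have hDL : ∀ n, ν.real (unburntPath Ξ t n) ≤ 1 - q := fun n =>
    hL ▸ measureReal_mono (unburntPath_subset_unburnt n)
  -- With `p` the probability at depth `n`, a branching root contributes `((1 - q) ^ 2 - (1 - q - p)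
  -- ^ 2) / 2` and an internal one `t * p / 2`. By the recursion for burning times, both events
  -- almost surely leave the root unburnt.
  have hstep : ∀ n, ν.real (unburntPath Ξ t n) *
      (1 - q + t / 2 - ν.real (unburntPath Ξ t n) / 2) ≤ ν.real (unburntPath Ξ t (n + 1)) := by
    intro n
    set L := unburnt Ξ t with hLdef
    set D := unburntPath Ξ t n with hDdef
    have hLm : MeasurableSet L := measurableSet_unburnt
    have hDm : MeasurableSet D := measurableSet_unburntPath n
    have hsub : D ⊆ L := unburntPath_subset_unburnt n
    set B₁ : Set (Mark × (Realisation × Realisation)) :=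
      (univ ×ˢ {1}) ×ˢ ((L ×ˢ L) \ ((L \ D) ×ˢ (L \ D))) with hB₁
    set B₂ : Set (Mark × (Realisation × Realisation)) :=
      (Iic t ×ˢ {0}) ×ˢ (D ×ˢ univ) with hB₂
    have hB₁m : MeasurableSet B₁ := (MeasurableSet.univ.prod (measurableSet_singleton _)).prod
      ((hLm.prod hLm).diff ((hLm.diff hDm).prod (hLm.diff hDm)))
    have hB₂m : MeasurableSet B₂ := (measurableSet_Iic.prod (measurableSet_singleton _)).prod
      (hDm.prod MeasurableSet.univ)
    have hd : Disjoint B₁ B₂ := Set.disjoint_left.2 fun p hp hp' => by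
      have h1 : p.1.2 = 1 := hp.1.2
      have h2 : p.1.2 = 0 := hp'.1.2
      rw [h1] at h2
      exact absurd h2 (by decide)
    have hB : (unifMark.prod (ν.prod ν)).real (B₁ ∪ B₂) =
        ν.real D * (1 - q + t / 2 - ν.real D / 2) := by
      rw [measureReal_union hd hB₂m, measureReal_prod_prod, measureReal_prod_prod,
        unifMark_real_prod_singleton, unifMark_real_prod_singleton,
        measureReal_sdiff (prod_mono sdiff_subset sdiff_subset)
          ((hLm.diff hDm).prod (hLm.diff hDm)),
        measureReal_prod_prod, measureReal_prod_prod, measureReal_prod_prod,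
        measureReal_sdiff hsub hDm, hL, probReal_univ, probReal_univ, real_volume_Iic]
      ring
    rw [← hB, hν, ← map_mark_shifted hω hF hs ha hr, map_measureReal_apply ((hω.measurable []).prodMk
      ((hm [0]).prodMk (hm [1]))) (hB₁m.union hB₂m), map_measureReal_apply (hm [])
      (measurableSet_unburntPath _)]
    refine ENNReal.toReal_mono (measure_ne_top _ _) (measure_mono_ae ?_)
    filter_upwards [ae_rootTime_eq_chi hΞ h0 hω hfr] with s hchi hsB
    rcases hsB with ⟨⟨-, h1⟩, ⟨h2, h3⟩, h4⟩ | ⟨⟨h1, h2⟩, h3, -⟩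
    · have hk : (ω [] s).2 = 1 := h1
      have h2' : (t : Time) < rootTime Ξ (shifted ω F [0] s) := h2
      have h3' : (t : Time) < rootTime Ξ (shifted ω F [1] s) := h3
      refine ⟨?_, Or.inl ⟨hk, ⟨h2, h3⟩, ?_⟩⟩
      · show (t : Time) < rootTime Ξ (shifted ω F [] s)
        rw [hchi, chi, if_neg (by rw [hk]; decide)]
        exact lt_min h2' h3'
      · by_contra! hno
        exact h4 ⟨⟨h2, hno.1⟩, ⟨h3, hno.2⟩⟩
    · have hk : (ω [] s).2 = 0 := h2
      have h3' : (t : Time) < rootTime Ξ (shifted ω F [0] s) := hsub h3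
      refine ⟨?_, Or.inr ⟨hk, h1, h3⟩⟩
      show (t : Time) < rootTime Ξ (shifted ω F [] s)
      rw [hchi, chi, if_pos hk]
      split_ifs
      · exact h3'
      · exact WithTop.coe_lt_top t
  -- `t - 2 * q` is the positive fixed point of `p ↦ p * (1 - q + t / 2 - p / 2)`, which increases
  -- on `p ≤ 1 - q`.
  have hlow : ∀ n, (t : ℝ) - 2 * q ≤ ν.real (unburntPath Ξ t n) := by
    intro n
    induction n with
    | zero =>
      show (t : ℝ) - 2 * q ≤ ν.real (unburnt Ξ t)
      linarith
    | succ n ih =>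
      refine le_trans ?_ (hstep n)
      have h1 := hDL n
      nlinarith
  have hlim : Filter.Tendsto (fun n => ν (unburntPath Ξ t n)) Filter.atTop
      (nhds (ν (⋂ n, unburntPath Ξ t n))) :=
    tendsto_measure_iInter_atTop (fun n => (measurableSet_unburntPath n).nullMeasurableSet)
      unburntPath_antitone ⟨0, measure_ne_top _ _⟩
  have hzero : ν (⋂ n, unburntPath Ξ t n) = 0 := by
    rw [hν, Measure.map_apply (hm []) (MeasurableSet.iInter measurableSet_unburntPath)]
    exact measure_mono_null (fun s hs (hf : FrozenEq Ξ _ _) =>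
      notMem_iInter_unburntPath ht hf hs) hfr
  have hge : ENNReal.ofReal ((t : ℝ) - 2 * q) ≤ ν (⋂ n, unburntPath Ξ t n) :=
    ge_of_tendsto' hlim fun n =>
      (ENNReal.ofReal_le_iff_le_toReal (measure_ne_top _ _)).2 (hlow n)
  rw [hzero, nonpos_iff_eq_zero, ENNReal.ofReal_eq_zero] at hge
  linarith

theorem isBurningLaw_map_rootTime [IsProbabilityMeasure P]
    (hΞ : IsClosed (insert 0 Ξ)) (h0 : (0 : unitInterval) ∉ Ξ)
    (hω : IsUniformMarking P ω) (hF : Measurable F)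
    (hfr : ∀ᵐ s ∂P, FrozenEq Ξ (fun i => ω i s) (F s))
    (hs : IsStationary P ω F) (ha : IsAdapted P ω F) (hr : RespectsTree P ω F) :
    IsBurningLaw Ξ (P.map fun s => rootTime Ξ (shifted ω F [] s)) := by
  have hm : Measurable fun s => rootTime Ξ (shifted ω F [] s) :=
    (measurable_rootTime Ξ).comp (measurable_shifted hω hF [])
  have hρp := Measure.isProbabilityMeasure_map (μ := P) hm.aemeasurable
  have hrde := solvesRDE_map_rootTime hΞ h0 hω hF hfr hs ha hr
  refine ⟨hrde, ?_, fun t ht => ?_⟩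
  -- Attainment of the infimum leaves only `0` as a possible value outside `Ξ ∪ {⊤}`, and solutions
  -- of the RDE have no mass there.
  · have hz := hrde.isRDECDF.zero
    rw [timeCDF, measureReal_eq_zero_iff, Measure.map_apply hm measurableSet_Iic] at hz
    rw [Measure.map_apply hm (measurableSet_coe_image_union_top hΞ)]
    refine measure_mono_null (fun s hs => ?_) hz
    simp only [mem_preimage, mem_compl_iff, mem_union, mem_singleton_iff, not_or] at hs
    obtain ⟨y, hy⟩ := WithTop.ne_top_iff_exists.1 hs.2
    rcases (mem_and_percolates_of_burningTime_eq hΞ hy.symm).1 with rfl | hyΞ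
    · exact hy.ge
    · exact absurd ⟨y, hyΞ, hy⟩ hs.1
  · exact (ENNReal.ofReal_le_iff_le_toReal (measure_ne_top _ _)).2
      (half_le_timeCDF hΞ h0 hω hF hfr hs ha hr ht)

end Random

end FrozenPerc
end

theorem lemma5 (Ξ : Set unitInterval) (hpos : Ξ ⊆ Set.Ioc 0 1)
    (hclosed : IsClosed ((↑) ⁻¹' Ξ : Set (Set.Ioc (0 : unitInterval) 1))) :
    ∃ ρ : MeasureTheory.Measure FrozenPerc.Time,
      (MeasureTheory.IsProbabilityMeasure ρ ∧ FrozenPerc.IsBurningLaw Ξ ρ) ∧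
      (∀ ρ' : MeasureTheory.Measure FrozenPerc.Time, MeasureTheory.IsProbabilityMeasure ρ' →
        FrozenPerc.IsBurningLaw Ξ ρ' → ρ' = ρ) ∧
      ∀ (S : Type*) [MeasurableSpace S] (P : MeasureTheory.Measure S)
        [MeasureTheory.IsProbabilityMeasure P]
        (ω : FrozenPerc.Word → S → FrozenPerc.Mark) (F : S → Set FrozenPerc.Word),
        FrozenPerc.IsUniformMarking P ω → Measurable F →
        (∀ᵐ s ∂P, FrozenPerc.FrozenEq Ξ (fun i => ω i s) (F s)) →
        FrozenPerc.IsStationary P ω F → FrozenPerc.IsAdapted P ω F →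
        FrozenPerc.RespectsTree P ω F →
        ProbabilityTheory.HasLaw
          (fun s => FrozenPerc.burningTime Ξ (fun i => ω i s) (F s) []) ρ P := by
  have hΞ := FrozenPerc.isClosed_insert_zero hclosed
  have h0 : (0 : unitInterval) ∉ Ξ := fun h => lt_irrefl _ (hpos h).1
  obtain ⟨ρ, hρp, hρ⟩ := FrozenPerc.exists_isBurningLaw hΞ
  refine ⟨ρ, ⟨hρp, hρ⟩, fun ρ' _ hρ' => hρ'.unique hΞ hρ, ?_⟩
  intro S _ P _ ω F hω hF hfr hs ha hr
  have hm : Measurable fun s => FrozenPerc.rootTime Ξ (FrozenPerc.shifted ω F [] s) :=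
    (FrozenPerc.measurable_rootTime Ξ).comp (FrozenPerc.measurable_shifted hω hF [])
  have hp := MeasureTheory.Measure.isProbabilityMeasure_map (μ := P) hm.aemeasurable
  -- Shifting by the empty word is the identity by definition, so `rootTime` here is the burning
  -- time of the statement.
  exact ⟨hm.aemeasurable,
    (FrozenPerc.isBurningLaw_map_rootTime hΞ h0 hω hF hfr hs ha hr).unique hΞ hρ⟩
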